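/- Let $\mathbb{F}_q$ be a finite field and $d\ge 1$. Let $\mathcal{A}$ be the subgroup of $\mathrm{Aut}(\mathrm{SL}(d,q))$ generated by the diagonal automorphisms (conjugations $X\mapsto D X D^{-1}$ by non-scalar invertible diagonal matrices $D\in\mathrm{GL}(d,q)$) and the inner automorphisms (conjugations by elements of $\mathrm{SL}(d,q)$). Let $\mathcal{B}$ be the subgroup generated by the graph automorphism $X\mapsto (X^{-1})^{T}$ and the field automorphisms (a field automorphism of $\mathbb{F}_q$ applied to every entry of a matrix). Then: 1. $\mathcal{A}\cong \mathrm{PGL}(d,q)$, where $\mathrm{PGL}(d,q)=\mathrm{GL}(d,q)/Z$ and $Z$ is the center of $\mathrm{GL}(d,q)$, i.e. the group of non-zero scalar matrices. 2. $\mathcal{A}$ is a normal subgroup of $\mathrm{Aut}(\mathrm{SL}(d,q))$ and $\mathrm{Aut}(\mathrm{SL}(d,q))=\mathcal{A}\mathcal{B}$. If moreover $d\neq 2$, then $\mathcal{A}\cap\mathcal{B}=1$, so that $\mathrm{Aut}(\mathrm{SL}(d,q))$ is the (internal) semidirect product $\mathcal{A}\rtimes\mathcal{B}$ of the normal subgroup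 $\mathcal{A}$ with $\mathcal{B}$. -/

import Mathlib

open Matrix
open scoped MatrixGroups

namespace SLAut

/-- Conjugation of `SL(d, F)` by an element of `GL(d, F)`: the automorphism `X ↦ g * X * g⁻¹`. -/
def conjAut {d : ℕ} {F : Type*} [Field F] (g : GL (Fin d) F) :
    MulAut (SpecialLinearGroup (Fin d) F) where
  toFun X := ⟨(g : Matrix (Fin d) (Fin d) F) * X.1 * ((g⁻¹ : GL (Fin d) F) :
      Matrix (Fin d) (Fin d) F), by rw [Matrix.det_units_conj, X.2]⟩
  invFun X := ⟨((g⁻¹ : GL (Fin d) F) : Matrix (Fin d) (Fin d) F) * X.1 *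
      (g : Matrix (Fin d) (Fin d) F), by rw [Matrix.det_units_conj', X.2]⟩
  left_inv X := by
    apply Subtype.ext
    simp only [Matrix.mul_assoc, Units.inv_mul, Matrix.mul_one, Units.inv_mul_cancel_left]
  right_inv X := by
    apply Subtype.ext
    simp only [Matrix.mul_assoc, Units.mul_inv, Matrix.mul_one, Units.mul_inv_cancel_left]
  map_mul' X Y := by
    apply Subtype.ext
    change _ * (X.1 * Y.1) * _ = (_ * X.1 * _) * (_ * Y.1 * _)
    simp only [Matrix.mul_assoc, Units.inv_mul_cancel_left]

/-- The graph automorphism `X ↦ (X⁻¹)ᵀ` of `SL(d, F)`. -/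
def graphAut (d : ℕ) (F : Type*) [Field F] : MulAut (SpecialLinearGroup (Fin d) F) where
  toFun X := (X⁻¹).transpose
  invFun X := (X⁻¹).transpose
  left_inv X := by
    apply Subtype.ext
    change (adjugate (adjugate X.1)ᵀ)ᵀ = X.1
    rw [← Matrix.adjugate_transpose, Matrix.transpose_transpose]
    exact congrArg Subtype.val (inv_inv X)
  right_inv X := by
    apply Subtype.ext
    change (adjugate (adjugate X.1)ᵀ)ᵀ = X.1
    rw [← Matrix.adjugate_transpose, Matrix.transpose_transpose]
    exact congrArg Subtype.val (inv_inv X)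
  map_mul' X Y := by
    apply Subtype.ext
    rw [_root_.mul_inv_rev]
    exact Matrix.transpose_mul (Y⁻¹).1 (X⁻¹).1

/-- The field automorphism of `SL(d, F)` that applies `σ` to every entry of a matrix. -/
def fieldAut (d : ℕ) {F : Type*} [Field F] (σ : F ≃+* F) :
    MulAut (SpecialLinearGroup (Fin d) F) where
  toFun := SpecialLinearGroup.map (σ : F →+* F)
  invFun := SpecialLinearGroup.map (σ.symm : F →+* F)
  left_inv X := by
    ext i j
    simp
  right_inv X := by
    ext i j
    simp
  map_mul' X Y := map_mul _ X Y

/-- The diagonal automorphisms: conjugations by invertible non-scalar diagonal matrices. -/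
def diagonalAuts (d : ℕ) (F : Type*) [Field F] : Set (MulAut (SpecialLinearGroup (Fin d) F)) :=
  {φ | ∃ D : GL (Fin d) F, (D : Matrix (Fin d) (Fin d) F).IsDiag ∧
    (∀ c : F, (D : Matrix (Fin d) (Fin d) F) ≠ Matrix.scalar (Fin d) c) ∧ φ = conjAut D}

/-- The inner automorphisms: conjugations by elements of `SL(d, F)`. -/
def innerAuts (d : ℕ) (F : Type*) [Field F] : Set (MulAut (SpecialLinearGroup (Fin d) F)) :=
  Set.range (MulAut.conj : SpecialLinearGroup (Fin d) F →* _)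

/-- The field automorphisms: those induced entrywise by automorphisms of the field. -/
def fieldAuts (d : ℕ) (F : Type*) [Field F] : Set (MulAut (SpecialLinearGroup (Fin d) F)) :=
  Set.range fun σ : F ≃+* F => fieldAut d σ

/-- The group `𝒜` generated by the diagonal and the inner automorphisms. -/
def groupA (d : ℕ) (F : Type*) [Field F] : Subgroup (MulAut (SpecialLinearGroup (Fin d) F)) :=
  Subgroup.closure (diagonalAuts d F ∪ innerAuts d F)

/-- The group `ℬ` generated by the graph and the field automorphisms. -/
def groupB (d : ℕ) (F : Type*) [Field F] : Subgroup (MulAut (SpecialLinearGroup (Fin d) F)) :=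
  Subgroup.closure ({graphAut d F} ∪ fieldAuts d F)

end SLAut

/-! Conjugation gives a homomorphism from GL to Aut(SL) whose kernel is the center and whose image
is `groupA`; this yields the isomorphism with PGL. The graph and field automorphisms normalize that
image, so normality follows once `groupA` and `groupB` are known to generate Aut(SL).

Generation is the hard part. The unitriangular group U is a Sylow subgroup, so an automorphism φ
carries it to a conjugate, and hence carries its center, the root subgroup at (first, last), to a
conjugate (`exists_conj_transvection_first_last`). Since permutations of the indices move this root
subgroup to every other one, φ sends each root subgroup into a family 1 + c·u fᵀ with fixed center u
and axis ker f (`exists_rootFrame`).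

The commutation and conjugacy relations among transvections then force either the centers or the
axes to depend only on the row index (`RootFrame.proportional_dichotomy`); the graph automorphism
exchanges the two cases. The centers and axes then form a basis and, up to scalars, its dual basis,
so a conjugation makes φ preserve every standard root subgroup. A diagonal conjugation normalizes
the coefficients, the Steinberg relations (for d = 2, Weyl elements and the torus) make them one
field automorphism, and transvections generate SL.

For d ≥ 3 the intersection is trivial by comparing actions on transvections; for d ≤ 1 the group SL
is trivial. For d = 2 the graph automorphism is inner. -/

namespace SLAut

/-! ### Conjugation by GL, and the group generated by graph and field automorphisms -/

section Conj

variable {d : ℕ} {F : Type*} [Field F]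

theorem coe_conjAut (g : GL (Fin d) F) (X : SpecialLinearGroup (Fin d) F) :
    (conjAut g X : Matrix (Fin d) (Fin d) F) =
      (g : Matrix (Fin d) (Fin d) F) * X.1 * ((g⁻¹ : GL (Fin d) F) : Matrix (Fin d) (Fin d) F) :=
  rfl

theorem coe_graphAut (X : SpecialLinearGroup (Fin d) F) :
    (graphAut d F X : Matrix (Fin d) (Fin d) F) = ((X⁻¹ : SpecialLinearGroup (Fin d) F) :
      Matrix (Fin d) (Fin d) F)ᵀ := rfl

theorem coe_fieldAut (σ : F ≃+* F) (X : SpecialLinearGroup (Fin d) F) :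
    (fieldAut d σ X : Matrix (Fin d) (Fin d) F) = X.1.map σ := rfl

theorem conjAut_one : conjAut (1 : GL (Fin d) F) = 1 := by
  ext1 X
  apply Subtype.ext
  simp [coe_conjAut]

theorem conjAut_mul (g h : GL (Fin d) F) : conjAut (g * h) = conjAut g * conjAut h := by
  ext1 X
  apply Subtype.ext
  rw [MulAut.mul_apply, coe_conjAut, coe_conjAut, coe_conjAut, _root_.mul_inv_rev]
  simp only [Units.val_mul, Matrix.mul_assoc]

variable (d F) in
/-- Conjugation of `SL(d, F)` by elements of `GL(d, F)`, as a group homomorphism. -/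
def conjHom : GL (Fin d) F →* MulAut (SpecialLinearGroup (Fin d) F) where
  toFun := conjAut
  map_one' := conjAut_one
  map_mul' := conjAut_mul

theorem conjAut_apply_eq_iff (g : GL (Fin d) F) (X Y : SpecialLinearGroup (Fin d) F) :
    conjAut g X = Y ↔ (g : Matrix (Fin d) (Fin d) F) * X.1 = Y.1 * g :=
  Subtype.ext_iff.trans (Units.mul_inv_eq_iff_eq_mul g)

/-- Commuting with 1 + E_ij is commuting with E_ij, and only scalars commute with all off-diagonal
matrix units. -/
theorem mem_center_of_conjAut_transvection (g : GL (Fin d) F)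
    (h : ∀ {i j : Fin d} (hij : i ≠ j), conjAut g (SpecialLinearGroup.transvection hij 1) =
      SpecialLinearGroup.transvection hij 1) : g ∈ Subgroup.center (GL (Fin d) F) := by
  rw [GeneralLinearGroup.mem_center_iff_val_mem_range_scalar]
  refine mem_range_scalar_of_commute_single fun i j hij => ?_
  have := h hij
  rw [conjAut_apply_eq_iff, SpecialLinearGroup.transvection_coe, mul_add, add_mul, mul_one,
    one_mul] at this
  exact (add_left_cancel this).symm

theorem ker_conjHom : (conjHom d F).ker = Subgroup.center (GL (Fin d) F) := by
  ext g
  constructor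
  · intro hg
    refine mem_center_of_conjAut_transvection g fun hij => ?_
    exact DFunLike.congr_fun (MonoidHom.mem_ker.1 hg) _
  · intro hg
    obtain ⟨c, hc⟩ := GeneralLinearGroup.mem_center_iff_val_mem_range_scalar.1 hg
    rw [MonoidHom.mem_ker]
    ext1 X
    refine (conjAut_apply_eq_iff _ _ _).2 ?_
    rw [← hc]
    exact scalar_comm c (Commute.all _) X.1

theorem conjAut_toGL (s : SpecialLinearGroup (Fin d) F) :
    conjAut (SpecialLinearGroup.toGL s) = MulAut.conj s := by
  ext1 X
  rw [conjAut_apply_eq_iff, MulAut.conj_apply]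
  change s.1 * X.1 = (s * X * s⁻¹ * s).1
  simp

/-- Write g = s·D with D = diag(det g, 1, …, 1) and s of determinant 1. If D happens to be scalar it
is not among the generators, but then it acts trivially. -/
theorem conjAut_mem_groupA (g : GL (Fin d) F) : conjAut g ∈ groupA d F := by
  have diag (D : GL (Fin d) F) (hD : (D : Matrix (Fin d) (Fin d) F).IsDiag) :
      conjAut D ∈ groupA d F := by
    by_cases h : ∃ c : F, (D : Matrix (Fin d) (Fin d) F) = Matrix.scalar (Fin d) c
    · obtain ⟨c, hc⟩ := h
      have : D ∈ (conjHom d F).ker := by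
        rw [ker_conjHom, GeneralLinearGroup.mem_center_iff_val_mem_range_scalar]
        exact ⟨c, hc.symm⟩
      rw [show conjAut D = 1 from this]
      exact one_mem _
    · exact Subgroup.subset_closure (Or.inl ⟨D, hD, not_exists.1 h, rfl⟩)
  rcases d with _ | d
  · rw [Subsingleton.elim g 1, conjAut_one]
    exact one_mem _
  · let v : Fin (d + 1) → F := Function.update 1 0 (g : Matrix (Fin (d + 1)) (Fin (d + 1)) F).det
    have hv : (diagonal v).det = (g : Matrix (Fin (d + 1)) (Fin (d + 1)) F).det := by
      rw [det_diagonal, Fin.prod_univ_succ]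
      simp [v]
    have hg : g.val.det ≠ 0 := (isUnits_det_units g).ne_zero
    let D : GL (Fin (d + 1)) F := GeneralLinearGroup.mkOfDetNeZero (diagonal v) (hv ▸ hg)
    have hDg : ((g * D⁻¹ : GL (Fin (d + 1)) F) : Matrix (Fin (d + 1)) (Fin (d + 1)) F).det = 1 := by
      rw [Units.val_mul, det_mul, ← hv]
      change (D : Matrix (Fin (d + 1)) (Fin (d + 1)) F).det * _ = 1
      rw [← det_mul, ← Units.val_mul, mul_inv_cancel, Units.val_one, det_one]
    let s : SpecialLinearGroup (Fin (d + 1)) F := ⟨_, hDg⟩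
    have : g = SpecialLinearGroup.toGL s * D := by
      have : SpecialLinearGroup.toGL s = g * D⁻¹ := Units.ext rfl
      rw [this, inv_mul_cancel_right]
    rw [this, conjAut_mul]
    refine mul_mem ?_ (diag D (isDiag_diagonal v))
    rw [conjAut_toGL]
    exact Subgroup.subset_closure (Or.inr ⟨s, rfl⟩)

theorem range_conjHom : (conjHom d F).range = groupA d F := by
  apply le_antisymm
  · rintro _ ⟨g, rfl⟩
    exact conjAut_mem_groupA g
  · refine (Subgroup.closure_le _).2 ?_
    rintro φ (⟨D, -, -, rfl⟩ | ⟨s, rfl⟩)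
    · exact ⟨D, rfl⟩
    · exact ⟨_, conjAut_toGL s⟩

theorem mem_groupA_iff {φ : MulAut (SpecialLinearGroup (Fin d) F)} :
    φ ∈ groupA d F ↔ ∃ g, conjAut g = φ := by
  rw [← range_conjHom]
  rfl

variable (d F) in
theorem nonempty_groupA_mulEquiv : Nonempty (groupA d F ≃* PGL(Fin d, F)) :=
  ⟨(MulEquiv.subgroupCongr range_conjHom).symm.trans
    ((QuotientGroup.quotientKerEquivRange (conjHom d F)).symm.trans
      (QuotientGroup.quotientMulEquivOfEq ker_conjHom))⟩

theorem graphAut_mul_self : graphAut d F * graphAut d F = 1 := by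
  ext1 X
  exact (graphAut d F).left_inv X

theorem graphAut_inv : (graphAut d F)⁻¹ = graphAut d F :=
  inv_eq_of_mul_eq_one_left graphAut_mul_self

theorem fieldAut_mul (σ τ : F ≃+* F) : fieldAut d σ * fieldAut d τ = fieldAut d (σ * τ) := rfl

theorem fieldAut_inv (σ : F ≃+* F) : (fieldAut d σ)⁻¹ = fieldAut d σ⁻¹ := rfl

theorem fieldAut_one : fieldAut d (1 : F ≃+* F) = 1 := rfl

theorem fieldAut_mul_graphAut (σ : F ≃+* F) :
    fieldAut d σ * graphAut d F = graphAut d F * fieldAut d σ := by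
  ext1 X
  apply Subtype.ext
  rw [MulAut.mul_apply, MulAut.mul_apply, coe_fieldAut, coe_graphAut, coe_graphAut, ← map_inv,
    coe_fieldAut, transpose_map]

theorem graphAut_mul_conjAut (g : GL (Fin d) F) :
    ∃ h, graphAut d F * conjAut g = conjAut h * graphAut d F := by
  refine ⟨⟨((g⁻¹ : GL (Fin d) F) : Matrix _ _ F)ᵀ, (g : Matrix _ _ F)ᵀ, ?_, ?_⟩, ?_⟩
  · rw [← transpose_mul, Units.mul_inv, transpose_one]
  · rw [← transpose_mul, Units.inv_mul, transpose_one]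
  · ext1 X
    apply Subtype.ext
    rw [MulAut.mul_apply, MulAut.mul_apply, coe_graphAut, coe_conjAut, ← map_inv, coe_conjAut,
      coe_graphAut, transpose_mul, transpose_mul, ← Matrix.mul_assoc]
    rfl

theorem fieldAut_mul_conjAut (σ : F ≃+* F) (g : GL (Fin d) F) :
    ∃ h, fieldAut d σ * conjAut g = conjAut h * fieldAut d σ := by
  refine ⟨GeneralLinearGroup.map (σ : F →+* F) g, ?_⟩
  ext1 X
  apply Subtype.ext
  rw [MulAut.mul_apply, MulAut.mul_apply, coe_fieldAut, coe_conjAut, coe_conjAut, ← map_inv,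
    coe_fieldAut]
  change (σ : F →+* F).mapMatrix _ = _
  rw [map_mul, map_mul]
  rfl

theorem mem_normalizer_groupA {γ : MulAut (SpecialLinearGroup (Fin d) F)}
    (h : ∀ g, ∃ h, γ * conjAut g = conjAut h * γ)
    (h' : ∀ g, ∃ h, γ⁻¹ * conjAut g = conjAut h * γ⁻¹) :
    γ ∈ Subgroup.normalizer (groupA d F : Set (MulAut (SpecialLinearGroup (Fin d) F))) := by
  rw [Subgroup.mem_normalizer_iff]
  intro φ
  simp only [mem_groupA_iff]
  constructor
  · rintro ⟨g, rfl⟩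
    obtain ⟨k, hk⟩ := h g
    exact ⟨k, by rw [hk, mul_inv_cancel_right]⟩
  · rintro ⟨g, hg⟩
    obtain ⟨k, hk⟩ := h' g
    refine ⟨k, ?_⟩
    rw [hg] at hk
    simpa [mul_assoc] using congrArg (· * γ) hk.symm

theorem groupB_le_normalizer : groupB d F ≤
    Subgroup.normalizer (groupA d F : Set (MulAut (SpecialLinearGroup (Fin d) F))) := by
  refine (Subgroup.closure_le _).2 ?_
  rintro _ (rfl | ⟨σ, rfl⟩)
  · refine mem_normalizer_groupA graphAut_mul_conjAut ?_
    rw [graphAut_inv]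
    exact graphAut_mul_conjAut
  · exact mem_normalizer_groupA (fieldAut_mul_conjAut σ) (fieldAut_mul_conjAut σ⁻¹)

theorem graphAut_mem_groupB : graphAut d F ∈ groupB d F :=
  Subgroup.subset_closure (Or.inl rfl)

theorem fieldAut_mem_groupB (σ : F ≃+* F) : fieldAut d σ ∈ groupB d F :=
  Subgroup.subset_closure (Or.inr ⟨σ, rfl⟩)

/-- The graph automorphism is an involution commuting with the field automorphisms, which already
form a group. -/
theorem exists_eq_of_mem_groupB {φ : MulAut (SpecialLinearGroup (Fin d) F)}
    (hφ : φ ∈ groupB d F) :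
    ∃ σ : F ≃+* F, φ = fieldAut d σ ∨ φ = graphAut d F * fieldAut d σ := by
  refine Subgroup.closure_induction (p := fun φ _ => ∃ σ : F ≃+* F, φ = fieldAut d σ ∨
    φ = graphAut d F * fieldAut d σ) ?_ ?_ ?_ ?_ hφ
  · rintro _ (rfl | ⟨σ, rfl⟩)
    · exact ⟨1, Or.inr (by rw [fieldAut_one, mul_one])⟩
    · exact ⟨σ, Or.inl rfl⟩
  · exact ⟨1, Or.inl rfl⟩
  · rintro _ _ - - ⟨σ, rfl | rfl⟩ ⟨τ, rfl | rfl⟩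
    · exact ⟨σ * τ, Or.inl rfl⟩
    · exact ⟨σ * τ, Or.inr (by rw [← mul_assoc, fieldAut_mul_graphAut, mul_assoc, fieldAut_mul])⟩
    · exact ⟨σ * τ, Or.inr rfl⟩
    · refine ⟨σ * τ, Or.inl ?_⟩
      rw [mul_assoc, ← mul_assoc (fieldAut d σ), fieldAut_mul_graphAut, mul_assoc (graphAut d F),
        ← mul_assoc, graphAut_mul_self, one_mul, fieldAut_mul]
  · rintro _ - ⟨σ, rfl | rfl⟩
    · exact ⟨σ⁻¹, Or.inl rfl⟩
    · refine ⟨σ⁻¹, Or.inr ?_⟩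
      rw [_root_.mul_inv_rev, fieldAut_inv, graphAut_inv, fieldAut_mul_graphAut]

theorem fieldAut_transvection (σ : F ≃+* F) {i j : Fin d} (hij : i ≠ j) (a : F) :
    fieldAut d σ (SpecialLinearGroup.transvection hij a) =
      SpecialLinearGroup.transvection hij (σ a) := by
  apply Subtype.ext
  rw [coe_fieldAut, SpecialLinearGroup.transvection_coe, SpecialLinearGroup.transvection_coe,
    Matrix.map_add _ (map_add σ), Matrix.map_one _ (map_zero σ) (map_one σ)]
  rw [map_single]

theorem graphAut_transvection {i j : Fin d} (hij : i ≠ j) (a : F) :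
    graphAut d F (SpecialLinearGroup.transvection hij a) =
      SpecialLinearGroup.transvection hij.symm (-a) := by
  apply Subtype.ext
  rw [coe_graphAut, SpecialLinearGroup.transvection_inv, SpecialLinearGroup.transvection_coe,
    SpecialLinearGroup.transvection_coe]
  simp

theorem exists_ne_ne (hd : 3 ≤ d) (i j : Fin d) : ∃ k, k ≠ i ∧ k ≠ j := by
  by_contra! hc
  have : (Finset.univ : Finset (Fin d)) ⊆ {i, j} := fun k _ => by
    by_cases hk : k = i
    · simp [hk]
    · simp [hc k hk]
  have := (Finset.card_le_card this).trans Finset.card_le_two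
  rw [Finset.card_univ, Fintype.card_fin] at this
  omega

theorem disjoint_groupA_groupB (hd : d ≠ 2) : Disjoint (groupA d F) (groupB d F) := by
  rw [Subgroup.disjoint_def]
  intro φ hA hB
  rcases lt_or_ge d 3 with h | h
  · have : Subsingleton (Fin d) := by
      rw [Fin.subsingleton_iff_le_one]
      omega
    ext1 X
    exact Subsingleton.elim _ _
  obtain ⟨g, rfl⟩ := mem_groupA_iff.1 hA
  obtain ⟨σ, hσ | hσ⟩ := exists_eq_of_mem_groupB hB
  · have : g ∈ (conjHom d F).ker := by
      rw [ker_conjHom]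
      refine mem_center_of_conjAut_transvection g fun hij => ?_
      rw [hσ, fieldAut_transvection, map_one]
    exact this
  · exfalso
    -- Here g E_ij = -E_ji g. For j different from i and k, the (k, j) entry reads g_ki = 0; such a
    -- j exists because d ≥ 3.
    have key (k i : Fin d) : (g : Matrix _ _ F) k i = 0 := by
      obtain ⟨j, hji, hjk⟩ := exists_ne_ne h i k
      have := (conjAut_apply_eq_iff g (SpecialLinearGroup.transvection hji.symm 1) _).1
        (by rw [hσ, MulAut.mul_apply, fieldAut_transvection, graphAut_transvection])
      rw [SpecialLinearGroup.transvection_coe, SpecialLinearGroup.transvection_coe, mul_add,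
        add_mul, mul_one, one_mul] at this
      have := congrFun₂ this k j
      simpa [hjk.symm] using this
    have hg : g.val.det ≠ 0 := (isUnits_det_units g).ne_zero
    have : g.val = 0 := by ext k i; exact key k i
    have hne : Nonempty (Fin d) := ⟨⟨0, by omega⟩⟩
    rw [this, det_zero] at hg
    exact hg rfl

end Conj

/-! ### The unitriangular Sylow subgroup and its center -/

section Unitriangular

variable {d : ℕ} {F : Type*} [Field F]

variable (d F) in
/-- The upper unitriangular matrices, as a submonoid of `GL(d, F)`. -/
def unitriangularSubmonoid : Submonoid (GL (Fin d) F) where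
  carrier := {g | ∀ i j, j ≤ i → g.val i j = (1 : Matrix (Fin d) (Fin d) F) i j}
  one_mem' _ _ _ := rfl
  mul_mem' {a b} ha hb i j hij := by
    rw [Units.val_mul, Matrix.mul_apply]
    have hz (k : Fin d) (hk : k ≠ i ∨ k ≠ j) : a.val i k * b.val k j = 0 := by
      rcases lt_or_ge k i with h | h
      · rw [ha i k h.le, Matrix.one_apply_ne h.ne', zero_mul]
      · rcases lt_or_ge j k with h' | h'
        · rw [hb k j h'.le, Matrix.one_apply_ne h'.ne', mul_zero]
        · omega
    rcases eq_or_ne i j with rfl | h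
    · rw [Finset.sum_eq_single i (fun k _ hk => hz k (Or.inl hk)) (by simp), ha i i le_rfl,
        hb i i le_rfl, Matrix.one_apply_eq, one_mul]
    · rw [Matrix.one_apply_ne h]
      exact Finset.sum_eq_zero fun k _ => hz k (by by_contra! hc; exact h (hc.1.symm.trans hc.2))

variable (d F) in
/-- The upper unitriangular subgroup of `GL(d, F)` over a finite field. -/
def unitriangular [Finite F] : Subgroup (GL (Fin d) F) where
  __ := unitriangularSubmonoid d F
  inv_mem' {a} ha := by
    -- In a finite group inverses are powers, so closure under products suffices.
    have hpos : 0 < orderOf a := orderOf_pos a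
    have h : a⁻¹ = a ^ (orderOf a - 1) := by
      rw [inv_eq_iff_mul_eq_one, ← pow_succ', Nat.sub_add_cancel hpos, pow_orderOf_eq_one]
    rw [h]
    exact (unitriangularSubmonoid d F).pow_mem ha _

/-- The upper unitriangular matrix with the given entries above the diagonal. -/
def unitriangularMatrix (v : ∀ j : Fin d, {i // i < j} → F) : Matrix (Fin d) (Fin d) F :=
  Matrix.of fun i j => if h : i < j then v j ⟨i, h⟩ else (1 : Matrix (Fin d) (Fin d) F) i j

theorem unitriangularMatrix_apply_of_le (v : ∀ j : Fin d, {i // i < j} → F) {i j : Fin d}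
    (h : j ≤ i) : unitriangularMatrix v i j = (1 : Matrix (Fin d) (Fin d) F) i j := by
  simp [unitriangularMatrix, h.not_gt]

theorem det_unitriangular {M : Matrix (Fin d) (Fin d) F}
    (hM : ∀ i j, j ≤ i → M i j = (1 : Matrix (Fin d) (Fin d) F) i j) : M.det = 1 := by
  rw [det_of_isUpperTriangular fun i j (hij : j < i) => by
    rw [hM i j hij.le, Matrix.one_apply_ne hij.ne']]
  exact Finset.prod_eq_one fun i _ => by rw [hM i i le_rfl, Matrix.one_apply_eq]

variable (d F) in
/-- Unitriangular matrices are determined by their entries above the diagonal. -/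
noncomputable def unitriangularEquiv [Finite F] :
    unitriangular d F ≃ (∀ j : Fin d, {i // i < j} → F) where
  toFun g j i := g.1.val i j
  invFun v := ⟨GeneralLinearGroup.mkOfDetNeZero (unitriangularMatrix v)
    (by rw [det_unitriangular fun i j => unitriangularMatrix_apply_of_le v]; exact one_ne_zero),
    fun i j => unitriangularMatrix_apply_of_le v⟩
  left_inv g := by
    refine Subtype.ext (Units.ext ?_)
    ext i j
    change unitriangularMatrix (fun j (i : {i // i < j}) => g.1.val i j) i j = g.1.val i j
    rcases lt_or_ge i j with h | h
    · simp [unitriangularMatrix, h]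
    · rw [unitriangularMatrix_apply_of_le _ h, g.2 i j h]
  right_inv v := by
    ext j i
    change unitriangularMatrix v i.1 j = v j i
    simp [unitriangularMatrix, i.2]

theorem card_unitriangular [Finite F] :
    Nat.card (unitriangular d F) = ∏ i : Fin d, Nat.card F ^ (i : ℕ) := by
  rw [Nat.card_congr (unitriangularEquiv d F), Nat.card_pi]
  refine Finset.prod_congr rfl fun i _ => ?_
  rw [Nat.card_fun, Nat.card_eq_fintype_card (α := {j // j < i}), Fintype.card_subtype]
  congr 1
  rw [← Fin.card_Iio i]
  congr 1
  ext
  simp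

/-- Each factor q^d - q^i of |GL| splits as q^i (q^(d-i) - 1), and the powers q^i make up the order
of the unitriangular group. -/
theorem index_unitriangular [Finite F] :
    (unitriangular d F).index = ∏ i : Fin d, (Nat.card F ^ (d - i) - 1) := by
  have := Fintype.ofFinite F
  have h := (unitriangular d F).card_mul_index
  rw [card_GL_field, card_unitriangular, Fintype.card_eq_nat_card] at h
  have h2 : ∏ i : Fin d, (Nat.card F ^ d - Nat.card F ^ (i : ℕ)) =
      (∏ i : Fin d, Nat.card F ^ (i : ℕ)) * ∏ i : Fin d, (Nat.card F ^ (d - i) - 1) := by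
    rw [← Finset.prod_mul_distrib]
    refine Finset.prod_congr rfl fun i _ => ?_
    rw [Nat.mul_sub, mul_one, ← pow_add, Nat.add_sub_cancel' i.2.le]
  rw [h2] at h
  exact Nat.eq_of_mul_eq_mul_left
    (Finset.prod_pos fun i _ => pow_pos Nat.card_pos _) h

variable (d F) in
/-- The upper unitriangular matrices form a Sylow subgroup of `GL(d, F)`. -/
theorem exists_sylow_unitriangular [Finite F] : ∃ p : ℕ, p.Prime ∧
    ∃ P : Sylow p (GL (Fin d) F), (P : Subgroup (GL (Fin d) F)) = unitriangular d F := by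
  have := Fintype.ofFinite F
  obtain ⟨p, hp⟩ := CharP.exists F
  obtain ⟨n, hprime, hcard⟩ := FiniteField.card F p
  have : Fact p.Prime := ⟨hprime⟩
  rw [Fintype.card_eq_nat_card] at hcard
  refine ⟨p, hprime, IsPGroup.toSylow (P := unitriangular d F)
    (IsPGroup.of_card (n := ∑ i : Fin d, n * (i : ℕ)) ?_) ?_, rfl⟩
  · rw [card_unitriangular, ← Finset.prod_pow_eq_pow_sum]
    refine Finset.prod_congr rfl fun i _ => ?_
    rw [hcard, pow_mul]
  -- Each factor q^(d-i) - 1 of the index is -1 modulo p, as d - i > 0.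
  · rw [index_unitriangular, hprime.prime.dvd_finsetProd_iff]
    rintro ⟨i, -, hi⟩
    have hpos : 0 < (n : ℕ) * (d - i) := Nat.mul_pos n.pos (Nat.sub_pos_of_lt i.2)
    have h1 : 1 ≤ p ^ ((n : ℕ) * (d - i)) := Nat.one_le_pow _ _ hprime.pos
    rw [hcard, ← pow_mul] at hi
    have h2 := (Nat.dvd_sub_iff_right h1 (dvd_pow_self p hpos.ne')).1 hi
    exact hprime.one_lt.ne' (Nat.dvd_one.1 h2)

/-- Up to an inner automorphism, every automorphism of `SL(d, F)` preserves the group of upper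
unitriangular matrices. -/
theorem exists_conj_mem_unitriangular_iff [Finite F] (φ : MulAut (SpecialLinearGroup (Fin d) F)) :
    ∃ h : SpecialLinearGroup (Fin d) F, ∀ X,
      SpecialLinearGroup.toGL (h⁻¹ * φ X * h) ∈ unitriangular d F ↔
        SpecialLinearGroup.toGL X ∈ unitriangular d F := by
  obtain ⟨p, hprime, P, hP⟩ := exists_sylow_unitriangular d F
  have : Fact p.Prime := ⟨hprime⟩
  -- Unitriangular matrices have determinant 1, so this Sylow subgroup of GL lies in SL and is Sylow
  -- there; Sylow conjugacy then applies inside SL.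
  have hle : (P : Subgroup (GL (Fin d) F)) ≤
      (SpecialLinearGroup.toGL : SpecialLinearGroup (Fin d) F →* _).range := by
    intro g hg
    rw [hP] at hg
    exact ⟨⟨g.val, det_unitriangular hg⟩, Units.ext rfl⟩
  let Q : Sylow p (SpecialLinearGroup (Fin d) F) := P.comapOfInjective SpecialLinearGroup.toGL
    SpecialLinearGroup.toGL_injective hle
  have hQ (X : SpecialLinearGroup (Fin d) F) :
      X ∈ Q ↔ SpecialLinearGroup.toGL X ∈ unitriangular d F := by
    rw [← hP]
    rfl
  obtain ⟨h, hh⟩ := MulAction.exists_smul_eq (SpecialLinearGroup (Fin d) F) Q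
    (Q.mapSurjective (f := φ.toMonoidHom) φ.surjective)
  refine ⟨h, fun X => ?_⟩
  rw [← hQ, ← hQ]
  have h1 : φ X ∈ h • Q ↔ X ∈ Q := by
    rw [hh]
    change φ X ∈ Subgroup.map φ.toMonoidHom Q ↔ _
    exact Subgroup.mem_map_iff_mem φ.injective
  rw [← h1]
  open scoped Pointwise in change _ ↔ φ X ∈ (MulAut.conj h • Q.toSubgroup)
  rw [Subgroup.mem_pointwise_smul_iff_inv_smul_mem, ← map_inv, MulAut.smul_def,
    MulAut.conj_apply, inv_inv]
  rfl

theorem toGL_transvection_mem_unitriangular [Finite F] {i j : Fin d} (hij : i < j) (a : F) :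
    SpecialLinearGroup.toGL (SpecialLinearGroup.transvection hij.ne a) ∈ unitriangular d F := by
  intro k l hkl
  change (1 + single i j a : Matrix (Fin d) (Fin d) F) k l = _
  rw [Matrix.add_apply, single_apply_of_ne, add_zero]
  rintro ⟨rfl, rfl⟩
  exact hij.not_ge hkl

theorem first_ne_last {n : ℕ} : (0 : Fin (n + 2)) ≠ Fin.last (n + 1) :=
  (Fin.last_pos).ne

/-- The center of the unitriangular group. -/
theorem exists_eq_transvection_of_commute [Finite F] {n : ℕ}
    {X : SpecialLinearGroup (Fin (n + 2)) F}
    (hX : SpecialLinearGroup.toGL X ∈ unitriangular (n + 2) F)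
    (hc : ∀ Y, SpecialLinearGroup.toGL Y ∈ unitriangular (n + 2) F → Y * X = X * Y) :
    ∃ a, X = SpecialLinearGroup.transvection first_ne_last a := by
  have key {i j : Fin (n + 2)} (hij : i < j) :
      X.1 * single i j (1 : F) = single i j (1 : F) * X.1 := by
    have := congrArg Subtype.val (hc _ (toGL_transvection_mem_unitriangular hij 1))
    change (1 + single i j (1 : F)) * X.1 = X.1 * (1 + single i j (1 : F)) at this
    rw [add_mul, mul_add, one_mul, mul_one] at this
    exact (add_left_cancel this).symm
  refine ⟨X.1 0 (Fin.last _), Subtype.ext ?_⟩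
  ext k l
  rw [SpecialLinearGroup.transvection_coe, Matrix.add_apply]
  rcases le_or_gt l k with hlk | hkl
  · rw [single_apply_of_ne, add_zero]
    · exact hX k l hlk
    · rintro ⟨rfl, rfl⟩
      exact Fin.last_pos.not_ge hlk
  · rw [Matrix.one_apply_ne hkl.ne, zero_add]
    -- An entry in row 0 before the last column is killed by commuting with E_(l,last); an entry in
    -- a lower row k by commuting with E_(0,k).
    by_cases hk : k = 0
    · subst hk
      by_cases hl : l = Fin.last _
      · subst hl
        simp
      · have := congrFun₂ (key (Fin.lt_last_iff_ne_last.2 hl)) 0 (Fin.last _)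
        simp [hkl.ne] at this
        simp [this, Ne.symm hl]
    · have := congrFun₂ (key (Fin.pos_iff_ne_zero.2 hk)) 0 l
      simp [hkl.ne'] at this
      simp [this, Ne.symm hk]

theorem transvection_commute_unitriangular [Finite F] {n : ℕ} (a : F)
    {Y : SpecialLinearGroup (Fin (n + 2)) F}
    (hY : SpecialLinearGroup.toGL Y ∈ unitriangular (n + 2) F) :
    Y * SpecialLinearGroup.transvection first_ne_last a =
      SpecialLinearGroup.transvection first_ne_last a * Y := by
  apply Subtype.ext
  change Y.1 * (1 + single _ _ a) = (1 + single _ _ a) * Y.1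
  rw [mul_add, add_mul, mul_one, one_mul]
  congr 1
  ext k l
  by_cases hk : k = 0
  · subst hk
    by_cases hl : l = Fin.last _
    · subst hl
      have h0 : Y.1 0 0 = 1 := by simpa using hY 0 0 le_rfl
      have h1 : Y.1 (Fin.last _) (Fin.last _) = 1 := by
        simpa using hY (Fin.last _) (Fin.last _) le_rfl
      simp [h0, h1]
    · have h1 : Y.1 (Fin.last _) l = 0 := by
        have := hY (Fin.last _) l (Fin.le_last _)
        rwa [Matrix.one_apply_ne (Ne.symm hl)] at this
      simp [hl, h1]
  · have h1 : Y.1 k 0 = 0 := by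
      have := hY k 0 (Fin.zero_le _)
      rwa [Matrix.one_apply_ne hk] at this
    by_cases hl : l = Fin.last _
    · subst hl
      simp [hk, h1]
    · simp [hk, hl]

/-- The image of the highest root subgroup under an automorphism of `SL(d, F)` is conjugate
to it. -/
theorem exists_conj_transvection_first_last [Finite F] {n : ℕ}
    (φ : MulAut (SpecialLinearGroup (Fin (n + 2)) F)) :
    ∃ h : SpecialLinearGroup (Fin (n + 2)) F, ∀ a : F, ∃ b : F,
      φ (SpecialLinearGroup.transvection first_ne_last a) =
        h * SpecialLinearGroup.transvection first_ne_last b * h⁻¹ := by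
  obtain ⟨h, hh⟩ := exists_conj_mem_unitriangular_iff φ
  refine ⟨h, fun a => ?_⟩
  obtain ⟨b, hb⟩ := exists_eq_transvection_of_commute
    (X := h⁻¹ * φ (SpecialLinearGroup.transvection first_ne_last a) * h)
    ((hh _).2 (toGL_transvection_mem_unitriangular Fin.last_pos a)) fun Y hY => by
      obtain ⟨Z, hZ⟩ := φ.surjective (h * Y * h⁻¹)
      have hYZ : Y = h⁻¹ * φ Z * h := by rw [hZ]; group
      have := congrArg φ (transvection_commute_unitriangular a ((hh Z).1 (hYZ ▸ hY)))
      rw [map_mul, map_mul] at this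
      rw [hYZ]
      calc h⁻¹ * φ Z * h * (h⁻¹ * φ (SpecialLinearGroup.transvection first_ne_last a) * h)
          = h⁻¹ * (φ Z * φ (SpecialLinearGroup.transvection first_ne_last a)) * h := by group
        _ = _ := by rw [this]; group
  exact ⟨b, by rw [← hb]; group⟩

end Unitriangular

/-! ### Proportional vectors and sums of rank-one matrices -/

section Proportional

variable {ι F : Type*} [Field F]

/-- Two vectors are proportional if they differ by a nonzero scalar. -/
def Proportional (u v : ι → F) : Prop := ∃ s : F, s ≠ 0 ∧ v = s • u

theorem Proportional.symm {u v : ι → F} : Proportional u v → Proportional v u := by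
  rintro ⟨s, hs, rfl⟩
  exact ⟨s⁻¹, inv_ne_zero hs, by rw [smul_smul, inv_mul_cancel₀ hs, one_smul]⟩

theorem Proportional.trans {u v w : ι → F} : Proportional u v → Proportional v w →
    Proportional u w := by
  rintro ⟨s, hs, rfl⟩ ⟨t, ht, rfl⟩
  exact ⟨t * s, mul_ne_zero ht hs, smul_smul _ _ _⟩

theorem proportional_of_minors {u v : ι → F} (hu : u ≠ 0) (hv : v ≠ 0)
    (h : ∀ i k, u i * v k = u k * v i) : Proportional u v := by
  obtain ⟨k, hk⟩ := Function.ne_iff.1 hu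
  rw [Pi.zero_apply] at hk
  have hvu : v = (v k / u k) • u := by
    ext i
    rw [Pi.smul_apply, smul_eq_mul]
    field_simp
    rw [mul_comm, ← h i k, mul_comm]
  refine ⟨v k / u k, fun h0 => hv ?_, hvu⟩
  rw [hvu, h0, zero_smul]

/-- The 2×2 minors of the right side vanish, while those of the left side factor as ab times a minor
of (u, v) times a minor of (f, g); the term in e drops out. -/
theorem proportional_of_add_eq_vecMulVec {u v f g x y : ι → F} (hu : u ≠ 0) (hv : v ≠ 0)
    (hf : f ≠ 0) (hg : g ≠ 0) {a b e : F} (ha : a ≠ 0) (hb : b ≠ 0)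
    (h : a • vecMulVec u f + b • vecMulVec v g + e • vecMulVec u g = vecMulVec x y) :
    Proportional u v ∨ Proportional f g := by
  have hM (i j : ι) : a * (u i * f j) + b * (v i * g j) + e * (u i * g j) = x i * y j := by
    simpa [vecMulVec_apply] using congrFun₂ h i j
  have hz (i k j l : ι) : (u i * v k - u k * v i) * (f j * g l - f l * g j) = 0 := by
    have : a * b * ((u i * v k - u k * v i) * (f j * g l - f l * g j)) = 0 := by
      linear_combination hM i j * (a * (u k * f l) + b * (v k * g l) + e * (u k * g l)) +
        x i * y j * hM k l - hM i l * (a * (u k * f j) + b * (v k * g j) + e * (u k * g j)) -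
        x i * y l * hM k j
    exact (mul_eq_zero.1 this).resolve_left (mul_ne_zero ha hb)
  by_cases hc : ∀ i k, u i * v k = u k * v i
  · exact Or.inl (proportional_of_minors hu hv hc)
  · push Not at hc
    obtain ⟨i, k, hik⟩ := hc
    exact Or.inr (proportional_of_minors hf hg fun j l =>
      sub_eq_zero.1 ((mul_eq_zero.1 (hz i k j l)).resolve_left (sub_ne_zero.2 hik)))

end Proportional

/-! ### Commutation relations between transvections -/

section Relations

open SpecialLinearGroup

variable {ι F : Type*} [DecidableEq ι] [Fintype ι] [CommRing F]

theorem transvection_mul_transvection_swap {i j k : ι} (hij : i ≠ j) (hjk : j ≠ k) (hik : i ≠ k)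
    (a b : F) : transvection hij a * transvection hjk b =
      transvection hjk b * transvection hik (a * b) * transvection hij a := by
  apply Subtype.ext
  change (1 + single i j a) * (1 + single j k b) =
    (1 + single j k b) * (1 + single i k (a * b)) * (1 + single i j a)
  simp only [mul_add, add_mul, mul_one, one_mul, single_mul_single_same, single_mul_single_of_ne,
    hik.symm, ne_eq, not_false_eq_true, add_zero]
  abel

theorem transvection_commute_of_row {i j k : ι} (hij : i ≠ j) (hik : i ≠ k) (a b : F) :
    Commute (transvection hij a) (transvection hik b) := by
  apply Subtype.ext
  change (1 + single i j a) * (1 + single i k b) = (1 + single i k b) * (1 + single i j a)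
  simp only [mul_add, add_mul, mul_one, one_mul, single_mul_single_of_ne, hij.symm,
    hik.symm, ne_eq, not_false_eq_true, add_zero]
  abel

theorem transvection_commute_of_col {i j k : ι} (hik : i ≠ k) (hjk : j ≠ k) (a b : F) :
    Commute (transvection hik a) (transvection hjk b) := by
  apply Subtype.ext
  change (1 + single i k a) * (1 + single j k b) = (1 + single j k b) * (1 + single i k a)
  simp only [mul_add, add_mul, mul_one, one_mul, single_mul_single_of_ne, hjk.symm,
    hik.symm, ne_eq, not_false_eq_true, add_zero]
  abel

theorem transvection_injective {i j : ι} (hij : i ≠ j) :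
    Function.Injective (transvection hij : F → SpecialLinearGroup ι F) := by
  intro a b h
  have := congrFun₂ (congrArg Subtype.val h) i j
  simpa [transvection_coe, hij] using this

theorem not_commute_transvection [Nontrivial F] {i j k : ι} (hij : i ≠ j) (hjk : j ≠ k) :
    ¬ Commute (transvection hij (1 : F)) (transvection hjk (1 : F)) := by
  intro h
  have := congrFun₂ (congrArg Subtype.val h.eq) i k
  simp [transvection_coe, mul_add, add_mul, hjk, hij.symm, hjk.symm] at this

end Relations

/-! ### Centers and axes of the images of root subgroups -/

section RootFrame

open SpecialLinearGroup

variable {d : ℕ} {F : Type*} [Field F]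

/-- The automorphism `φ` maps the root subgroup at `(i, j)` into the root subgroup with center
`u i j` and axis the kernel of `f i j`. -/
structure RootFrame (φ : MulAut (SpecialLinearGroup (Fin d) F))
    (u f : Fin d → Fin d → Fin d → F) (c : Fin d → Fin d → F → F) : Prop where
  ne_zero_left : ∀ {i j}, i ≠ j → u i j ≠ 0
  ne_zero_right : ∀ {i j}, i ≠ j → f i j ≠ 0
  dotProduct_eq_zero : ∀ {i j}, i ≠ j → f i j ⬝ᵥ u i j = 0
  map_transvection : ∀ {i j} (hij : i ≠ j) (a : F),
    (φ (transvection hij a)).1 = 1 + c i j a • vecMulVec (u i j) (f i j)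

variable (F) in
/-- Reindexing of matrices by a permutation, as an automorphism of `SL(d, F)`. -/
def permAut (e : Equiv.Perm (Fin d)) : MulAut (SpecialLinearGroup (Fin d) F) where
  toFun X := ⟨X.1.submatrix e.symm e.symm, by rw [det_submatrix_equiv_self, X.2]⟩
  invFun X := ⟨X.1.submatrix e e, by rw [det_submatrix_equiv_self, X.2]⟩
  left_inv X := by
    apply Subtype.ext
    ext
    simp
  right_inv X := by
    apply Subtype.ext
    ext
    simp
  map_mul' X Y := by
    apply Subtype.ext
    exact (submatrix_mul_equiv X.1 Y.1 _ _ _).symm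

theorem permAut_transvection (e : Equiv.Perm (Fin d)) {i j k l : Fin d} (hij : i ≠ j)
    (hkl : k ≠ l) (hk : e i = k) (hl : e j = l) (a : F) :
    permAut F e (transvection hij a) = transvection hkl a := by
  subst hk hl
  apply Subtype.ext
  change (1 + single i j a).submatrix e.symm e.symm = 1 + single (e i) (e j) a
  rw [submatrix_add, Pi.add_apply, Pi.add_apply, submatrix_one_equiv]
  congr 1
  ext k l
  simp [single_apply, Equiv.eq_symm_apply]

theorem exists_perm_first_last {n : ℕ} {i j : Fin (n + 2)} (hij : i ≠ j) :
    ∃ e : Equiv.Perm (Fin (n + 2)), e 0 = i ∧ e (Fin.last (n + 1)) = j := by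
  refine ⟨Equiv.swap (Equiv.swap 0 i (Fin.last (n + 1))) j * Equiv.swap 0 i, ?_, ?_⟩
  · rw [Equiv.Perm.mul_apply, Equiv.swap_apply_left, Equiv.swap_apply_of_ne_of_ne _ hij]
    conv_lhs => rw [← Equiv.swap_apply_left 0 i]
    exact (Equiv.swap 0 i).injective.ne first_ne_last
  · rw [Equiv.Perm.mul_apply, Equiv.swap_apply_left]

theorem exists_root_image [Finite F] {n : ℕ} (φ : MulAut (SpecialLinearGroup (Fin (n + 2)) F))
    {i j : Fin (n + 2)} (hij : i ≠ j) :
    ∃ (u f : Fin (n + 2) → F) (c : F → F), u ≠ 0 ∧ f ≠ 0 ∧ f ⬝ᵥ u = 0 ∧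
      ∀ a, (φ (transvection hij a)).1 = 1 + c a • vecMulVec u f := by
  obtain ⟨e, he0, hel⟩ := exists_perm_first_last hij
  obtain ⟨h, hh⟩ := exists_conj_transvection_first_last (φ * permAut F e)
  choose c hc using hh
  have hinv : (h⁻¹).1 * h.1 = 1 := congrArg Subtype.val (inv_mul_cancel h)
  have hinv' : h.1 * (h⁻¹).1 = 1 := congrArg Subtype.val (mul_inv_cancel h)
  -- h E_(0,last) h⁻¹ is the first column of h times the last row of h⁻¹.
  refine ⟨fun k => h.1 k 0, fun k => (h⁻¹).1 (Fin.last _) k, c, ?_, ?_, ?_, ?_⟩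
  · intro h0
    have := congrFun₂ hinv 0 0
    rw [Matrix.mul_apply, Finset.sum_eq_zero fun k _ => by rw [congrFun h0 k]; exact mul_zero _,
      Matrix.one_apply_eq] at this
    exact zero_ne_one this
  · intro h0
    have := congrFun₂ hinv (Fin.last _) (Fin.last _)
    rw [Matrix.mul_apply, Finset.sum_eq_zero fun k _ => by rw [congrFun h0 k]; exact zero_mul _,
      Matrix.one_apply_eq] at this
    exact zero_ne_one this
  · have := congrFun₂ hinv (Fin.last _) 0
    rw [Matrix.one_apply_ne first_ne_last.symm] at this
    exact this
  · intro a
    rw [← permAut_transvection e first_ne_last hij he0 hel, ← MulAut.mul_apply, hc]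
    change h.1 * (1 + single _ _ (c a)) * (h⁻¹).1 = _
    rw [mul_add, add_mul, mul_one, hinv']
    congr 1
    ext k l
    rw [Matrix.mul_apply, Finset.sum_eq_single (Fin.last _)]
    · simp [vecMulVec_apply]
      ring
    · intro b _ hb
      rw [mul_single_apply_of_ne _ _ _ _ _ hb, zero_mul]
    · simp

theorem exists_rootFrame [Finite F] {n : ℕ} (φ : MulAut (SpecialLinearGroup (Fin (n + 2)) F)) :
    ∃ u f c, RootFrame φ u f c := by
  have h (i j : Fin (n + 2)) : ∃ (u f : Fin (n + 2) → F) (c : F → F), ∀ hij : i ≠ j,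
      u ≠ 0 ∧ f ≠ 0 ∧ f ⬝ᵥ u = 0 ∧
        ∀ a, (φ (transvection hij a)).1 = 1 + c a • vecMulVec u f := by
    by_cases hij : i = j
    · exact ⟨0, 0, 0, fun h => absurd hij h⟩
    · obtain ⟨u, f, c, H⟩ := exists_root_image φ hij
      exact ⟨u, f, c, fun _ => H⟩
  choose u f c H using h
  exact ⟨u, f, c, fun hij => (H _ _ hij).1, fun hij => (H _ _ hij).2.1,
    fun hij => (H _ _ hij).2.2.1, fun hij => (H _ _ hij).2.2.2⟩

namespace RootFrame

variable {φ : MulAut (SpecialLinearGroup (Fin d) F)} {u f : Fin d → Fin d → Fin d → F}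
  {c : Fin d → Fin d → F → F}

/-- Composing with the graph automorphism exchanges centers and axes, so each statement about
centers yields its dual. -/
theorem graph (H : RootFrame φ u f c) :
    RootFrame (graphAut d F * φ) f u (fun i j a => c i j (-a)) where
  ne_zero_left := H.ne_zero_right
  ne_zero_right := H.ne_zero_left
  dotProduct_eq_zero hij := by rw [dotProduct_comm, H.dotProduct_eq_zero hij]
  map_transvection hij a := by
    rw [MulAut.mul_apply, coe_graphAut, ← map_inv, transvection_inv, H.map_transvection,
      transpose_add, transpose_one, transpose_smul, transpose_vecMulVec]

theorem coeff_ne_zero (H : RootFrame φ u f c) {i j : Fin d} (hij : i ≠ j) {a : F} (ha : a ≠ 0) :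
    c i j a ≠ 0 := by
  intro h0
  have h1 := H.map_transvection hij a
  rw [h0, zero_smul, add_zero] at h1
  have h2 : φ (transvection hij a) = 1 := Subtype.ext h1
  rw [map_eq_one_iff _ φ.injective, ← transvection_coeff_zero hij] at h2
  exact ha (transvection_injective hij h2)

theorem commute_one_add_smul_iff {s t : F} (hs : s ≠ 0) (ht : t ≠ 0)
    {A B : Matrix (Fin d) (Fin d) F} : Commute (1 + s • A) (1 + t • B) ↔ Commute A B := by
  constructor
  · intro h
    have h1 := (h.sub_left (Commute.one_left _)).sub_right (Commute.one_right _)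
    rw [add_sub_cancel_left, add_sub_cancel_left] at h1
    have h2 := (h1.smul_left s⁻¹).smul_right t⁻¹
    rwa [smul_smul, inv_mul_cancel₀ hs, one_smul, smul_smul, inv_mul_cancel₀ ht, one_smul] at h2
  · intro h
    exact (Commute.one_left _).add_left ((Commute.one_right _).add_right
      ((h.smul_left s).smul_right t))

theorem commute_iff (H : RootFrame φ u f c) {i j k l : Fin d} (hij : i ≠ j) (hkl : k ≠ l) :
    Commute (transvection hij (1 : F)) (transvection hkl (1 : F)) ↔
      Commute (vecMulVec (u i j) (f i j)) (vecMulVec (u k l) (f k l)) := by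
  rw [← commute_one_add_smul_iff (H.coeff_ne_zero hij one_ne_zero)
    (H.coeff_ne_zero hkl one_ne_zero), ← H.map_transvection hij, ← H.map_transvection hkl]
  constructor
  · intro h
    exact congrArg Subtype.val (h.map φ).eq
  · intro h
    apply φ.injective
    rw [map_mul, map_mul]
    exact Subtype.ext h.eq

theorem not_commute (H : RootFrame φ u f c) {i j k : Fin d} (hij : i ≠ j) (hjk : j ≠ k) :
    ¬ Commute (vecMulVec (u i j) (f i j)) (vecMulVec (u j k) (f j k)) := fun h =>
  not_commute_transvection (F := F) hij hjk ((H.commute_iff hij hjk).2 h)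

theorem commute_of_dotProduct {u v f g : Fin d → F} (h₁ : f ⬝ᵥ v = 0) (h₂ : g ⬝ᵥ u = 0) :
    Commute (vecMulVec u f) (vecMulVec v g) := by
  rw [commute_iff_eq, vecMulVec_mul_vecMulVec, vecMulVec_mul_vecMulVec, h₁, h₂]
  simp

/-- Proportional centers would make both cross pairings of center and axis vanish, so the images
would commute, although E_ij and E_jk do not. -/
theorem not_proportional_left (H : RootFrame φ u f c) {i j k : Fin d} (hij : i ≠ j)
    (hjk : j ≠ k) : ¬ Proportional (u i j) (u j k) := by
  rintro ⟨s, hs, h⟩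
  have h2 := H.dotProduct_eq_zero hjk
  refine H.not_commute hij hjk (commute_of_dotProduct ?_ ?_)
  · rw [h, dotProduct_smul, H.dotProduct_eq_zero hij, smul_zero]
  · rw [h, dotProduct_smul, smul_eq_mul] at h2
    exact (mul_eq_zero.1 h2).resolve_left hs

theorem not_proportional_right (H : RootFrame φ u f c) {i j k : Fin d} (hij : i ≠ j)
    (hjk : j ≠ k) : ¬ Proportional (f i j) (f j k) :=
  H.graph.not_proportional_left hij hjk

/-- Otherwise the images at (i, j) and (i, k) would have the same commutation behavior; but (j, k)
commutes with (i, k) and not with (i, j). -/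
theorem not_proportional_both (H : RootFrame φ u f c) {i j k : Fin d} (hij : i ≠ j)
    (hik : i ≠ k) (hjk : j ≠ k) (hu : Proportional (u i j) (u i k)) :
    ¬ Proportional (f i j) (f i k) := by
  rintro ⟨t, ht, h'⟩
  obtain ⟨s, hs, h⟩ := hu
  have h1 := (H.commute_iff hik hjk).1 (transvection_commute_of_col hik hjk 1 1)
  rw [h, h', vecMulVec_smul, smul_vecMulVec] at h1
  refine H.not_commute hij hjk ?_
  have h2 := (h1.smul_left t⁻¹).smul_left s⁻¹
  rwa [smul_smul t⁻¹, inv_mul_cancel₀ ht, one_smul, smul_smul, inv_mul_cancel₀ hs, one_smul] at h2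

/-- The conjugate maps to 1 plus a matrix of rank one, and expanding the image of the product gives
the sum treated in `proportional_of_add_eq_vecMulVec`. -/
theorem proportional_of_mul_eq_conj (H : RootFrame φ u f c) {i j k l : Fin d} (hij : i ≠ j)
    (hkl : k ≠ l) (g : SpecialLinearGroup (Fin d) F)
    (h : transvection hij 1 * transvection hkl 1 = g * transvection hij (1 : F) * g⁻¹) :
    Proportional (u i j) (u k l) ∨ Proportional (f i j) (f k l) := by
  have h1 := congrArg (fun X => (φ X).1) h
  simp only [map_mul] at h1
  change (φ (transvection hij 1)).1 * (φ (transvection hkl 1)).1 =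
    (φ g).1 * (φ (transvection hij 1)).1 * (φ g⁻¹).1 at h1
  have hg : (φ g).1 * (φ g⁻¹).1 = 1 := by
    rw [map_inv]
    exact congrArg Subtype.val (mul_inv_cancel (φ g))
  rw [H.map_transvection, H.map_transvection] at h1
  generalize (φ g).1 = G at h1 hg
  generalize (φ g⁻¹).1 = G' at h1 hg
  rw [add_mul, mul_add, mul_add, mul_add, add_mul, mul_one, one_mul,
    mul_one, mul_one, hg, smul_mul_smul_comm, vecMulVec_mul_vecMulVec, add_assoc] at h1
  have h2 := add_left_cancel h1
  rw [mul_smul_comm, smul_mul_assoc, mul_vecMulVec, vecMulVec_mul, vecMulVec_smul, smul_smul] at h2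
  refine proportional_of_add_eq_vecMulVec (H.ne_zero_left hij) (H.ne_zero_left hkl)
    (H.ne_zero_right hij) (H.ne_zero_right hkl) (H.coeff_ne_zero hij one_ne_zero)
    (H.coeff_ne_zero hkl one_ne_zero)
    (e := c i j 1 * c k l 1 * (f i j ⬝ᵥ u k l)) (x := c i j 1 • G *ᵥ u i j) (y := f i j ᵥ* G') ?_
  rw [smul_vecMulVec, ← h2]
  abel

theorem proportional_row (H : RootFrame φ u f c) {i j k : Fin d} (hij : i ≠ j) (hik : i ≠ k)
    (hjk : j ≠ k) : Proportional (u i j) (u i k) ∨ Proportional (f i j) (f i k) := by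
  refine H.proportional_of_mul_eq_conj hij hik (transvection hjk (-1)) ?_
  have h1 := transvection_mul_transvection_swap hij hjk hik (1 : F) 1
  rw [mul_one, mul_assoc, (transvection_commute_of_row hik hij 1 1).eq] at h1
  rw [transvection_inv, neg_neg, mul_assoc _ (transvection hij 1), h1, ← mul_assoc,
    ← transvection_inv, inv_mul_cancel, one_mul]

theorem proportional_col (H : RootFrame φ u f c) {i j k : Fin d} (hij : i ≠ j) (hik : i ≠ k)
    (hjk : j ≠ k) : Proportional (u i j) (u k j) ∨ Proportional (f i j) (f k j) := by
  refine H.proportional_of_mul_eq_conj hij hjk.symm (transvection hik.symm 1) ?_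
  have h1 := transvection_mul_transvection_swap hik.symm hij hjk.symm (1 : F) 1
  rw [h1, mul_one, mul_inv_cancel_right]

theorem proportional_right_of_left (H : RootFrame φ u f c) {i j k : Fin d} (hij : i ≠ j)
    (hik : i ≠ k) (hjk : j ≠ k) (h : Proportional (u i j) (u i k)) :
    Proportional (f i j) (f k j) :=
  (H.proportional_col hij hik hjk).resolve_left fun h' =>
    H.not_proportional_left hik hjk.symm (h.symm.trans h')

theorem proportional_left_of_right (H : RootFrame φ u f c) {i j k : Fin d} (hij : i ≠ j)
    (hik : i ≠ k) (hjk : j ≠ k) (h : Proportional (f i j) (f k j)) :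
    Proportional (u i j) (u i k) :=
  (H.proportional_row hij hik hjk).resolve_right fun h' =>
    H.not_proportional_right hik hjk.symm (h'.symm.trans h)

/-- Transfers the proportionality of centers from row i to row k, by way of the axes in column j. -/
theorem proportional_swap (H : RootFrame φ u f c) {i j k : Fin d} (hij : i ≠ j)
    (hik : i ≠ k) (hjk : j ≠ k) (h : Proportional (u i j) (u i k)) :
    Proportional (u k j) (u k i) :=
  H.proportional_left_of_right hjk.symm hik.symm hij.symm
    (H.proportional_right_of_left hij hik hjk h).symm

theorem proportional_extend (H : RootFrame φ u f c) {i j k l : Fin d} (hij : i ≠ j)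
    (hik : i ≠ k) (hjk : j ≠ k) (hil : i ≠ l) (h : Proportional (u i j) (u i k)) :
    Proportional (u i j) (u i l) := by
  rcases eq_or_ne j l with rfl | hjl
  · exact ⟨1, one_ne_zero, (one_smul _ _).symm⟩
  rcases eq_or_ne k l with rfl | hkl
  · exact h
  by_contra hn
  have h1 := (H.proportional_row hij hil hjl).resolve_left hn
  refine (H.proportional_row hik hil hkl).elim (fun h2 => hn (h.trans h2)) fun h2 => ?_
  exact H.not_proportional_both hij hik hjk h (h1.trans h2.symm)

theorem proportional_all (H : RootFrame φ u f c) {i j k : Fin d} (hij : i ≠ j)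
    (hik : i ≠ k) (hjk : j ≠ k) (h : Proportional (u i j) (u i k)) {l m n : Fin d}
    (hlm : l ≠ m) (hln : l ≠ n) : Proportional (u l m) (u l n) := by
  have row {i j k : Fin d} (hij : i ≠ j) (hik : i ≠ k) (hjk : j ≠ k)
      (h : Proportional (u i j) (u i k)) {m n : Fin d} (him : i ≠ m) (hin : i ≠ n) :
      Proportional (u i m) (u i n) :=
    (H.proportional_extend hij hik hjk him h).symm.trans (H.proportional_extend hij hik hjk hin h)
  rcases eq_or_ne l i with rfl | hli
  · exact row hij hik hjk h hlm hln
  -- The swap from row i to row l needs a third index.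
  · obtain ⟨r, hri, hrl⟩ : ∃ r : Fin d, i ≠ r ∧ r ≠ l := by
      by_cases hjl : j = l
      · exact ⟨k, hik, fun hkl => hjk (hjl.trans hkl.symm)⟩
      · exact ⟨j, hij, hjl⟩
    exact row hrl.symm hli hri.symm
      (H.proportional_swap hri hli.symm hrl (row hij hik hjk h hri hli.symm)) hlm hln

/-- Up to the graph automorphism, the centers of the images of root subgroups are determined by
the row index. -/
theorem proportional_dichotomy (H : RootFrame φ u f c) :
    (∀ {i j k}, i ≠ j → i ≠ k → Proportional (u i j) (u i k)) ∨
      (∀ {i j k}, i ≠ j → i ≠ k → Proportional (f i j) (f i k)) := by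
  by_cases h : ∃ i j k, i ≠ j ∧ i ≠ k ∧ j ≠ k ∧ Proportional (u i j) (u i k)
  · obtain ⟨i, j, k, hij, hik, hjk, h⟩ := h
    exact Or.inl fun h1 h2 => H.proportional_all hij hik hjk h h1 h2
  · refine Or.inr fun {i j k} hij hik => ?_
    rcases eq_or_ne j k with rfl | hjk
    · exact ⟨1, one_ne_zero, (one_smul _ _).symm⟩
    · exact (H.proportional_row hij hik hjk).resolve_left fun h' =>
        h ⟨i, j, k, hij, hik, hjk, h'⟩

end RootFrame

end RootFrame

/-! ### Moving the root subgroups to standard position -/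

section Standardize

open SpecialLinearGroup

variable {d : ℕ} {F : Type*} [Field F] {φ : MulAut (SpecialLinearGroup (Fin d) F)}

theorem Proportional.vecMulVec {ι : Type*} {u v f g : ι → F} (h : Proportional u v)
    (h' : Proportional f g) : ∃ s : F, vecMulVec v g = s • vecMulVec u f := by
  obtain ⟨s, -, rfl⟩ := h
  obtain ⟨t, -, rfl⟩ := h'
  exact ⟨t * s, by rw [vecMulVec_smul, smul_vecMulVec, smul_smul]⟩

theorem Proportional.dotProduct_eq_zero {u v f g : Fin d → F} (h : Proportional u v)
    (h' : Proportional f g) (h0 : f ⬝ᵥ u = 0) : g ⬝ᵥ v = 0 := by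
  obtain ⟨s, -, rfl⟩ := h
  obtain ⟨t, -, rfl⟩ := h'
  rw [smul_dotProduct, dotProduct_smul, h0, smul_zero, smul_zero]

/-- An automorphism mapping root elements to root elements relative to another basis and dual basis
maps, up to conjugation, root elements to root elements with the same indices. -/
theorem exists_conjAut_mul_transvection {U V : Fin d → Fin d → F} {c : Fin d → Fin d → F → F}
    (h0 : ∀ {i j}, i ≠ j → V j ⬝ᵥ U i = 0) (h1 : ∀ i, V i ⬝ᵥ U i ≠ 0)
    (hφ : ∀ {i j} (hij : i ≠ j) (a : F),
      (φ (transvection hij a)).1 = 1 + c i j a • vecMulVec (U i) (V j)) :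
    ∃ (g : GL (Fin d) F) (c' : Fin d → Fin d → F → F), ∀ {i j} (hij : i ≠ j) (a : F),
      (conjAut g * φ) (transvection hij a) = transvection hij (c' i j a) := by
  -- The pairing matrix is diagonal with nonzero entries, so the U i form a basis; conjugating by
  -- its inverse matrix sends U i to the standard basis.
  have hVU : Matrix.of V * (Matrix.of U)ᵀ = diagonal fun i => V i ⬝ᵥ U i := by
    ext i j
    rw [Matrix.mul_apply]
    change V i ⬝ᵥ U j = _
    rcases eq_or_ne i j with rfl | h
    · rw [diagonal_apply_eq]
    · rw [diagonal_apply_ne _ h, h0 h.symm]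
  have hdet : (Matrix.of U)ᵀ.det ≠ 0 := by
    have := congrArg det hVU
    rw [det_mul, det_diagonal] at this
    exact right_ne_zero_of_mul (this ▸ Finset.prod_ne_zero_iff.2 fun i _ => h1 i)
  let M : GL (Fin d) F := GeneralLinearGroup.mkOfDetNeZero _ hdet
  refine ⟨M⁻¹, fun i j a => c i j a * (V j ⬝ᵥ U j), fun {i j} hij a => ?_⟩
  have : φ (transvection hij a) =
      conjAut M (transvection hij (c i j a * (V j ⬝ᵥ U j))) := by
    symm
    rw [conjAut_apply_eq_iff, hφ]
    change (Matrix.of U)ᵀ * (1 + single i j _) = (1 + _) * (Matrix.of U)ᵀ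
    rw [mul_add, add_mul, mul_one, one_mul, smul_mul_assoc, vecMulVec_mul]
    congr 1
    ext k l
    rw [Matrix.smul_apply, vecMulVec_apply]
    have hl : (V j ᵥ* (Matrix.of U)ᵀ) l = V j ⬝ᵥ U l := rfl
    rw [hl]
    rcases eq_or_ne l j with rfl | h
    · simp
      ring
    · simp [h, h0 h]
  rw [MulAut.mul_apply, this, ← MulAut.mul_apply, ← conjAut_mul, inv_mul_cancel, conjAut_one,
    MulAut.one_apply]

theorem RootFrame.exists_conjAut_of_three_le {u f : Fin d → Fin d → Fin d → F}
    {c : Fin d → Fin d → F → F} (H : RootFrame φ u f c) (hd : 3 ≤ d)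
    (hu : ∀ {i j k}, i ≠ j → i ≠ k → Proportional (u i j) (u i k)) :
    ∃ (g : GL (Fin d) F) (c' : Fin d → Fin d → F → F), ∀ {i j} (hij : i ≠ j) (a : F),
      (conjAut g * φ) (transvection hij a) = transvection hij (c' i j a) := by
  have hf {i j k : Fin d} (hij : i ≠ j) (hkj : k ≠ j) : Proportional (f i j) (f k j) := by
    rcases eq_or_ne i k with rfl | hik
    · exact ⟨1, one_ne_zero, (one_smul _ _).symm⟩
    · exact H.proportional_right_of_left hij hik hkj.symm (hu hij hik)
  choose n hn using fun i : Fin d => (exists_ne_ne hd i i).imp fun _ h => h.1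
  have hs (i j : Fin d) : ∃ s : F, i ≠ j → vecMulVec (u i j) (f i j) =
      s • vecMulVec (u i (n i)) (f (n j) j) := by
    by_cases hij : i = j
    · exact ⟨0, fun h => absurd hij h⟩
    · obtain ⟨s, hs⟩ := (hu (hn i).symm hij).vecMulVec (hf (hn j) hij)
      exact ⟨s, fun _ => hs⟩
  choose s hs using hs
  have h0 {i j : Fin d} (hij : i ≠ j) : f (n j) j ⬝ᵥ u i (n i) = 0 :=
    (hu hij (hn i).symm).dotProduct_eq_zero (hf hij (hn j)) (H.dotProduct_eq_zero hij)
  refine exists_conjAut_mul_transvection (U := fun i => u i (n i)) (V := fun j => f (n j) j)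
    (c := fun i j a => c i j a * s i j) h0 (fun i hi => ?_) fun hij a => ?_
  -- If V i paired to zero with U i, the images at (n i, i) and (i, k) would commute for k outside
  -- {i, n i}.
  · obtain ⟨k, hki, hkn⟩ := exists_ne_ne hd i (n i)
    refine H.not_commute (hn i) hki.symm (RootFrame.commute_of_dotProduct ?_ ?_)
    · exact (hu (hn i).symm hki.symm).dotProduct_eq_zero (hf (hn i) (hn i)) hi
    · exact (hu (hn _).symm (hn i)).dotProduct_eq_zero (hf (hn k) hki.symm) (h0 hkn.symm)
  · rw [H.map_transvection, hs _ _ hij, smul_smul]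

theorem proportional_of_orthogonal_fin_two {u v f : Fin 2 → F} (hu : u ≠ 0) (hv : v ≠ 0)
    (hf : f ≠ 0) (hfu : f ⬝ᵥ u = 0) (hfv : f ⬝ᵥ v = 0) : Proportional u v := by
  rw [dotProduct, Fin.sum_univ_two] at hfu hfv
  have h : u 0 * v 1 = u 1 * v 0 := by
    by_contra hne
    have hD : u 0 * v 1 - u 1 * v 0 ≠ 0 := sub_ne_zero.2 hne
    refine hf (funext fun i => ?_)
    fin_cases i
    · exact (mul_eq_zero.1 (show f 0 * (u 0 * v 1 - u 1 * v 0) = 0 by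
        linear_combination v 1 * hfu - u 1 * hfv)).resolve_right hD
    · exact (mul_eq_zero.1 (show f 1 * (u 0 * v 1 - u 1 * v 0) = 0 by
        linear_combination u 0 * hfv - v 0 * hfu)).resolve_right hD
  refine proportional_of_minors hu hv fun i k => ?_
  fin_cases i <;> fin_cases k
  · rfl
  · exact h
  · exact h.symm
  · rfl

theorem RootFrame.exists_conjAut_of_two {φ : MulAut (SpecialLinearGroup (Fin 2) F)}
    {u f : Fin 2 → Fin 2 → Fin 2 → F}
    {c : Fin 2 → Fin 2 → F → F} (H : RootFrame φ u f c) :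
    ∃ (g : GL (Fin 2) F) (c' : Fin 2 → Fin 2 → F → F), ∀ {i j} (hij : i ≠ j) (a : F),
      (conjAut g * φ) (transvection hij a) = transvection hij (c' i j a) := by
  have hr (i : Fin 2) : i ≠ i.rev := by revert i; decide
  have hrev {i j : Fin 2} (hij : i ≠ j) : j = i.rev := by revert i j; decide
  have h0 {i j : Fin 2} (hij : i ≠ j) : f j.rev j ⬝ᵥ u i i.rev = 0 := by
    obtain rfl := hrev hij
    rw [Fin.rev_rev]
    exact H.dotProduct_eq_zero hij
  refine exists_conjAut_mul_transvection (U := fun i => u i i.rev) (V := fun j => f j.rev j)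
    (c := c) h0 (fun i hi => ?_) fun {i j} hij a => ?_
  -- Both centers would lie in the kernel of the same nonzero functional, which is a line in
  -- dimension 2.
  · have hp : Proportional (u i.rev i) (u i i.rev) :=
      proportional_of_orthogonal_fin_two (f := f i.rev i) (H.ne_zero_left (hr i).symm)
        (H.ne_zero_left (hr i)) (H.ne_zero_right (hr i).symm)
        (H.dotProduct_eq_zero (hr i).symm) hi
    exact H.not_proportional_left (hr i).symm (hr i) hp
  · obtain rfl := hrev hij
    rw [H.map_transvection, Fin.rev_rev]

/-- Up to conjugation and the graph automorphism, every automorphism of `SL(d, F)` preserves each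
of the standard root subgroups. -/
theorem exists_graph_conjAut_transvection [Finite F] (hd : 2 ≤ d)
    (φ : MulAut (SpecialLinearGroup (Fin d) F)) :
    ∃ (γ : MulAut (SpecialLinearGroup (Fin d) F)) (g : GL (Fin d) F)
      (c : Fin d → Fin d → F → F), γ ∈ groupB d F ∧ ∀ {i j} (hij : i ≠ j) (a : F),
        (conjAut g * (γ * φ)) (transvection hij a) = transvection hij (c i j a) := by
  obtain ⟨n, rfl⟩ := Nat.exists_eq_add_of_le' hd
  obtain ⟨u, f, c, H⟩ := exists_rootFrame φ
  rcases n with _ | n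
  · obtain ⟨g, c', h⟩ := H.exists_conjAut_of_two
    exact ⟨1, g, c', one_mem _, by rwa [one_mul]⟩
  · rcases H.proportional_dichotomy with hu | hf
    · obtain ⟨g, c', h⟩ := H.exists_conjAut_of_three_le (by omega) hu
      exact ⟨1, g, c', one_mem _, by rwa [one_mul]⟩
    · obtain ⟨g, c', h⟩ := H.graph.exists_conjAut_of_three_le (by omega) hf
      exact ⟨_, g, c', graphAut_mem_groupB, h⟩

end Standardize

/-! ### Generation by transvections -/

section DiagonalField

open SpecialLinearGroup

variable {d : ℕ} {F : Type*} [Field F] {φ : MulAut (SpecialLinearGroup (Fin d) F)}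

theorem conjAut_diagonal_transvection {D : Fin d → F} (hD : (diagonal D).det ≠ 0) {i j : Fin d}
    (hij : i ≠ j) (a : F) :
    conjAut (GeneralLinearGroup.mkOfDetNeZero _ hD) (transvection hij a) =
      transvection hij (D i * a * (D j)⁻¹) := by
  have hj : D j ≠ 0 := by
    rw [det_diagonal] at hD
    exact Finset.prod_ne_zero_iff.1 hD j (Finset.mem_univ j)
  rw [conjAut_apply_eq_iff]
  change diagonal D * (1 + single i j a) = (1 + single i j _) * diagonal D
  rw [mul_add, add_mul, mul_one, one_mul]
  congr 1
  ext k l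
  rw [diagonal_mul, mul_diagonal]
  by_cases h : i = k ∧ j = l
  · obtain ⟨rfl, rfl⟩ := h
    simp [hj]
  · rw [single_apply_of_ne _ _ _ _ _ h, single_apply_of_ne _ _ _ _ _ h, mul_zero, zero_mul]

/-- This is the classical h(a) = w(a) w(-1) with Weyl elements w(a) = x_ij(a) x_ji(-a⁻¹) x_ij(a). -/
theorem diag2n_eq_transvection_mul {ι F : Type*} [Fintype ι] [DecidableEq ι] [Field F] {i j : ι}
    (hij : i ≠ j) {a : F} (ha : a ≠ 0) :
    diag2n hij a ha = transvection hij a * transvection hij.symm (-a⁻¹) * transvection hij a *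
      (transvection hij (-1) * transvection hij.symm 1 * transvection hij (-1)) := by
  have w (b : F) (hb : b ≠ 0) : (1 + single i j b) * (1 + single j i (-b⁻¹)) * (1 + single i j b) =
      1 - single i i 1 - single j j 1 + single i j b - single j i b⁻¹ := by
    simp only [mul_add, add_mul, mul_one, one_mul, single_mul_single_same, single_mul_single_of_ne,
      hij.symm, ne_eq, not_false_eq_true, add_zero, mul_neg, neg_mul, mul_inv_cancel₀ hb,
      inv_mul_cancel₀ hb, ← single_neg]
    abel
  have w1 := w (-1) (neg_ne_zero.2 one_ne_zero)
  rw [inv_neg, inv_one, neg_neg] at w1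
  apply Subtype.ext
  change diagonal _ = (1 + single i j a) * (1 + single j i (-a⁻¹)) * (1 + single i j a) *
    ((1 + single i j (-1)) * (1 + single j i 1) * (1 + single i j (-1)))
  rw [w a ha, w1]
  have : diagonal (fun k => if k = i then a else if k = j then a⁻¹ else 1) =
      (1 - single i i 1 - single j j 1 + single i i a + single j j a⁻¹ : Matrix ι ι F) := by
    ext k l
    rcases eq_or_ne k l with rfl | hkl
    · rcases eq_or_ne k i with rfl | hki
      · simp [hij.symm]
      · rcases eq_or_ne k j with rfl | hkj
        · simp [hki, hki.symm]
        · simp [hki, hki.symm, hkj, hkj.symm]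
    · have (m : ι) : ¬ (m = k ∧ m = l) := fun h => hkl (h.1.symm.trans h.2)
      simp [hkl, this]
  rw [this]
  simp only [mul_add, add_mul, mul_sub, sub_mul, mul_one, one_mul, single_mul_single_same,
    single_mul_single_of_ne, hij, hij.symm, ne_eq, not_false_eq_true, add_zero, mul_neg,
    ← single_neg, sub_zero]
  abel

theorem transvection_induction [Nontrivial (Fin d)] {P : SpecialLinearGroup (Fin d) F → Prop}
    (h : ∀ {i j : Fin d} (hij : i ≠ j) (a : F), P (transvection hij a))
    (hmul : ∀ A B, P A → P B → P (A * B)) (X : SpecialLinearGroup (Fin d) F) : P X := by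
  refine diagonal_transvection_induction' P X (fun i j hij a ha => ?_) (fun i j hij a => h hij a)
    hmul
  rw [diag2n_eq_transvection_mul]
  exact hmul _ _ (hmul _ _ (hmul _ _ (h _ _) (h _ _)) (h _ _))
    (hmul _ _ (hmul _ _ (h _ _) (h _ _)) (h _ _))

theorem eq_fieldAut_of_transvection (hd : 2 ≤ d) (σ : F ≃+* F)
    (h : ∀ {i j : Fin d} (hij : i ≠ j) (a : F),
      φ (transvection hij a) = transvection hij (σ a)) : φ = fieldAut d σ := by
  have : Nontrivial (Fin d) := Fin.nontrivial_iff_two_le.2 hd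
  ext1 X
  refine transvection_induction (P := fun X => φ X = fieldAut d σ X) (fun hij a => ?_)
    (fun A B hA hB => ?_) X
  · rw [h, fieldAut_transvection]
  · rw [map_mul, map_mul, hA, hB]

end DiagonalField

/-! ### From root coefficients to a field automorphism -/

section RootCoefficients

open SpecialLinearGroup

variable {d : ℕ} {F : Type*} [Field F] {φ : MulAut (SpecialLinearGroup (Fin d) F)}
  {c : Fin d → Fin d → F → F}

theorem rootCoeff_add
    (h : ∀ {i j : Fin d} (hij : i ≠ j) (a : F), φ (transvection hij a) = transvection hij (c i j a))
    {i j : Fin d} (hij : i ≠ j) (a b : F) : c i j (a + b) = c i j a + c i j b := by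
  apply transvection_injective hij
  rw [transvection_add, ← h, ← h, ← h, transvection_add, map_mul]

theorem rootCoeff_injective
    (h : ∀ {i j : Fin d} (hij : i ≠ j) (a : F), φ (transvection hij a) = transvection hij (c i j a))
    {i j : Fin d} (hij : i ≠ j) : Function.Injective (c i j) := fun a b hab =>
  transvection_injective hij (φ.injective (by rw [h, h, hab]))

theorem rootCoeff_zero
    (h : ∀ {i j : Fin d} (hij : i ≠ j) (a : F), φ (transvection hij a) = transvection hij (c i j a))
    {i j : Fin d} (hij : i ≠ j) : c i j 0 = 0 := by
  simpa using rootCoeff_add h hij 0 0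

theorem rootCoeff_mul
    (h : ∀ {i j : Fin d} (hij : i ≠ j) (a : F), φ (transvection hij a) = transvection hij (c i j a))
    {i j k : Fin d} (hij : i ≠ j) (hjk : j ≠ k) (hik : i ≠ k) (a b : F) :
    c i k (a * b) = c i j a * c j k b := by
  apply transvection_injective hik
  have h1 := congrArg φ (transvection_mul_transvection_swap hij hjk hik a b)
  rw [map_mul, map_mul, map_mul, h, h, h, transvection_mul_transvection_swap hij hjk hik] at h1
  exact (mul_left_cancel (mul_right_cancel h1)).symm

/-- An additive and multiplicative injection of a finite field into itself, as an automorphism. -/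
noncomputable def fieldEquivOfInjective [Finite F] (s : F → F) (hs : Function.Injective s)
    (hadd : ∀ a b, s (a + b) = s a + s b) (hmul : ∀ a b, s (a * b) = s a * s b) : F ≃+* F where
  __ := Equiv.ofBijective s (Finite.injective_iff_bijective.1 hs)
  map_add' := hadd
  map_mul' := hmul

theorem exists_eq_fieldAut_of_three_le [Finite F] (hd : 3 ≤ d)
    (h : ∀ {i j : Fin d} (hij : i ≠ j) (a : F), φ (transvection hij a) = transvection hij (c i j a))
    {o : Fin d} (h1 : ∀ j, o ≠ j → c o j 1 = 1) : ∃ σ : F ≃+* F, φ = fieldAut d σ := by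
  -- c_ok(1) = c_oj(1) c_jk(1) gives c_jk(1) = 1, and then c_ok(a) = c_oj(a) c_jk(1) gives the
  -- claim.
  have hrow {j k : Fin d} (hoj : o ≠ j) (hok : o ≠ k) (a : F) : c o j a = c o k a := by
    rcases eq_or_ne j k with rfl | hjk
    · rfl
    · have h2 := rootCoeff_mul h hoj hjk hok 1 1
      have h3 := rootCoeff_mul h hoj hjk hok a 1
      rw [mul_one, h1 k hok, h1 j hoj, one_mul] at h2
      rw [mul_one, ← h2, mul_one] at h3
      exact h3.symm
  obtain ⟨l, hlo, -⟩ := exists_ne_ne hd o o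
  have hcol {j k : Fin d} (hoj : o ≠ j) (hok : o ≠ k) (hjk : j ≠ k) (a : F) :
      c j k a = c o l a := by
    have h2 := rootCoeff_mul h hoj hjk hok 1 a
    rw [one_mul, h1 j hoj, one_mul] at h2
    rw [← h2, hrow hok hlo.symm]
  have hall {j k : Fin d} (hjk : j ≠ k) (a : F) : c j k a = c o l a := by
    rcases eq_or_ne o j with rfl | hoj
    · exact hrow hjk hlo.symm a
    · rcases eq_or_ne o k with rfl | hok
      · obtain ⟨m, hmo, hmj⟩ := exists_ne_ne hd o j
        have h2 := rootCoeff_mul h hjk hmo.symm hmj.symm a 1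
        rw [mul_one, h1 m hmo.symm, mul_one] at h2
        rw [← h2, hcol hoj hmo.symm hmj.symm]
      · exact hcol hoj hok hjk a
  have hmul (a b : F) : c o l (a * b) = c o l a * c o l b := by
    obtain ⟨m, hmo, hml⟩ := exists_ne_ne hd o l
    rw [rootCoeff_mul h hmo.symm hml hlo.symm, hall hmo.symm, hall hml]
  refine ⟨fieldEquivOfInjective (c o l) (rootCoeff_injective h hlo.symm)
    (rootCoeff_add h hlo.symm) hmul, eq_fieldAut_of_transvection (by omega) _ fun hij a => ?_⟩
  rw [h, hall hij]
  rfl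

theorem weyl_mul_transvection {a : F} (ha : a ≠ 0) :
    (transvection zero_ne_one a * transvection one_ne_zero (-a⁻¹) * transvection zero_ne_one a :
        SL(2, F)) * transvection zero_ne_one 1 =
      transvection one_ne_zero (-(a⁻¹ * a⁻¹)) * (transvection zero_ne_one a *
        transvection one_ne_zero (-a⁻¹) * transvection zero_ne_one a) := by
  ext i j
  fin_cases i <;> fin_cases j <;>
    simp [transvection_coe, Matrix.mul_apply, Fin.sum_univ_two, ha]

/-- Converse to `weyl_mul_transvection`: this relation, which an automorphism preserves, recovers
the link between the two parameters. The (0, 1) entry already suffices. -/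
theorem mul_eq_neg_one_of_weyl {x y z : F}
    (h : (transvection zero_ne_one x * transvection one_ne_zero y * transvection zero_ne_one x :
        SL(2, F)) * transvection zero_ne_one 1 =
      transvection one_ne_zero z * (transvection zero_ne_one x *
        transvection one_ne_zero y * transvection zero_ne_one x)) : x * y = -1 := by
  have h1 := congrFun₂ (congrArg Subtype.val h) 0 1
  simp [transvection_coe, Matrix.mul_apply, Fin.sum_univ_two] at h1
  linear_combination h1

theorem diag2_mul_diag2 {a b : F} (ha : a ≠ 0) (hb : b ≠ 0) :
    (diag2 a ha * diag2 b hb : SL(2, F)) = diag2 (a * b) (mul_ne_zero ha hb) := by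
  apply Subtype.ext
  change (diag2 a ha).1 * (diag2 b hb).1 = (diag2 (a * b) (mul_ne_zero ha hb)).1
  simp only [diag2_coe']
  simp [mul_comm]

/-- With no third index, `rootCoeff_mul` is unavailable. The Weyl relation ties c 1 0 to the inverse
of c 0 1, so the torus element diag(a, a⁻¹) goes to the one with parameter c 0 1 a, and
multiplicativity is read off from the torus. -/
theorem exists_eq_fieldAut_of_two [Finite F] {φ : MulAut SL(2, F)} {c : Fin 2 → Fin 2 → F → F}
    (h : ∀ {i j : Fin 2} (hij : i ≠ j) (a : F), φ (transvection hij a) = transvection hij (c i j a))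
    (h1 : c 0 1 1 = 1) : ∃ σ : F ≃+* F, φ = fieldAut 2 σ := by
  have hne {a : F} (ha : a ≠ 0) : c 0 1 a ≠ 0 := fun h0 =>
    ha (rootCoeff_injective h zero_ne_one (h0.trans (rootCoeff_zero h zero_ne_one).symm))
  have hinv {a : F} (ha : a ≠ 0) : c 1 0 (-a⁻¹) = -(c 0 1 a)⁻¹ := by
    have h2 := congrArg φ (weyl_mul_transvection ha)
    simp only [map_mul, h, h1] at h2
    have h3 := mul_eq_neg_one_of_weyl h2
    exact mul_left_cancel₀ (hne ha) (by rw [h3, mul_neg, mul_inv_cancel₀ (hne ha)])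
  have hneg (a : F) : c 0 1 (-a) = -c 0 1 a := by
    have h2 := rootCoeff_add h zero_ne_one a (-a)
    rw [add_neg_cancel, rootCoeff_zero h zero_ne_one] at h2
    linear_combination -h2
  have h1' : c 1 0 1 = 1 := by
    have h2 := hinv (neg_ne_zero.2 (one_ne_zero (α := F)))
    rwa [hneg, h1, inv_neg, inv_one, neg_neg] at h2
  have hdiag {a : F} (ha : a ≠ 0) : φ (diag2 a ha) = diag2 (c 0 1 a) (hne ha) := by
    rw [diag2_def, diag2_def, diag2n_eq_transvection_mul, diag2n_eq_transvection_mul]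
    simp only [map_mul, h, hinv ha, hneg, h1, h1']
  have hmul (a b : F) : c 0 1 (a * b) = c 0 1 a * c 0 1 b := by
    rcases eq_or_ne a 0 with rfl | ha
    · rw [zero_mul, rootCoeff_zero h zero_ne_one, zero_mul]
    rcases eq_or_ne b 0 with rfl | hb
    · rw [mul_zero, rootCoeff_zero h zero_ne_one, mul_zero]
    have h2 := congrArg φ (diag2_mul_diag2 ha hb)
    rw [map_mul, hdiag ha, hdiag hb, hdiag, diag2_mul_diag2] at h2
    have h3 := congrFun₂ (congrArg Subtype.val h2) 0 0
    rw [diag2_coe', diag2_coe'] at h3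
    exact h3.symm
  have hsymm (a : F) : c 1 0 a = c 0 1 a := by
    rcases eq_or_ne a 0 with rfl | ha
    · rw [rootCoeff_zero h zero_ne_one, rootCoeff_zero h one_ne_zero]
    · have h2 := hinv (neg_ne_zero.2 (inv_ne_zero ha))
      rw [inv_neg, inv_inv, neg_neg, hneg, inv_neg, neg_neg] at h2
      rw [h2]
      refine inv_eq_of_mul_eq_one_left ?_
      rw [← hmul, mul_inv_cancel₀ ha, h1]
  refine ⟨fieldEquivOfInjective (c 0 1) (rootCoeff_injective h zero_ne_one)
    (rootCoeff_add h zero_ne_one) hmul, eq_fieldAut_of_transvection le_rfl _ fun {i j} hij a => ?_⟩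
  rw [h]
  congr 1
  change _ = c 0 1 a
  have : i = 0 ∧ j = 1 ∨ i = 1 ∧ j = 0 := by omega
  rcases this with ⟨rfl, rfl⟩ | ⟨rfl, rfl⟩
  · rfl
  · exact hsymm a

/-- An automorphism of `SL(d, F)` preserving each standard root subgroup is the composition of a
field automorphism and conjugation by a diagonal matrix. -/
theorem exists_conjAut_mul_eq_fieldAut [Finite F] (hd : 2 ≤ d)
    (h : ∀ {i j : Fin d} (hij : i ≠ j) (a : F),
      φ (transvection hij a) = transvection hij (c i j a)) :
    ∃ (g : GL (Fin d) F) (σ : F ≃+* F), conjAut g * φ = fieldAut d σ := by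
  let o : Fin d := ⟨0, by omega⟩
  -- Conjugation by D multiplies the (i, j) coefficient by D i / D j, so this choice makes every
  -- coefficient in row o equal to 1 at a = 1.
  let D : Fin d → F := fun j => if o = j then 1 else c o j 1
  have hDj (j : Fin d) : D j ≠ 0 := by
    by_cases hj : o = j
    · simp [D, hj]
    · simp only [D, hj, if_false]
      intro h0
      exact one_ne_zero (rootCoeff_injective h hj (h0.trans (rootCoeff_zero h hj).symm))
  have hD : (diagonal D).det ≠ 0 := by
    rw [det_diagonal]
    exact Finset.prod_ne_zero_iff.2 fun j _ => hDj j
  let g := GeneralLinearGroup.mkOfDetNeZero _ hD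
  have hg {i j : Fin d} (hij : i ≠ j) (a : F) :
      (conjAut g * φ) (transvection hij a) = transvection hij (D i * c i j a * (D j)⁻¹) := by
    rw [MulAut.mul_apply, h, conjAut_diagonal_transvection]
  have h1 (j : Fin d) (hj : o ≠ j) : D o * c o j 1 * (D j)⁻¹ = 1 := by
    have hoj : D j = c o j 1 := if_neg hj
    rw [hoj, show D o = 1 from if_pos rfl, one_mul, mul_inv_cancel₀ (hoj ▸ hDj j)]
  refine ⟨g, ?_⟩
  rcases hd.lt_or_eq with h3 | rfl
  · exact exists_eq_fieldAut_of_three_le (c := fun i j a => D i * c i j a * (D j)⁻¹) h3 hg h1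
  · exact exists_eq_fieldAut_of_two (c := fun i j a => D i * c i j a * (D j)⁻¹) hg
      (h1 1 zero_ne_one)

variable (d F) in
theorem groupA_sup_groupB [Finite F] : groupA d F ⊔ groupB d F = ⊤ := by
  refine eq_top_iff.2 fun φ _ => ?_
  rcases lt_or_ge d 2 with hd | hd
  · have : Subsingleton (Fin d) := by
      rw [Fin.subsingleton_iff_le_one]
      omega
    rw [show φ = 1 from MulEquiv.ext fun X => Subsingleton.elim _ _]
    exact one_mem _
  obtain ⟨γ, g, c, hγ, hc⟩ := exists_graph_conjAut_transvection hd φ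
  obtain ⟨D, σ, hσ⟩ := exists_conjAut_mul_eq_fieldAut hd hc
  have : φ = γ⁻¹ * ((conjAut g)⁻¹ * ((conjAut D)⁻¹ * fieldAut d σ)) := by
    rw [← hσ]
    group
  rw [this]
  have hA : groupA d F ≤ groupA d F ⊔ groupB d F := le_sup_left
  have hB : groupB d F ≤ groupA d F ⊔ groupB d F := le_sup_right
  exact mul_mem (inv_mem (hB hγ)) (mul_mem (inv_mem (hA (conjAut_mem_groupA g)))
    (mul_mem (inv_mem (hA (conjAut_mem_groupA D))) (hB (fieldAut_mem_groupB σ))))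

variable (d F) in
theorem groupA_normal [Finite F] : (groupA d F).Normal := by
  rw [← Subgroup.normalizer_eq_top_iff, eq_top_iff, ← groupA_sup_groupB d F]
  exact sup_le Subgroup.le_normalizer groupB_le_normalizer

end RootCoefficients

end SLAut

theorem theorem1 (d : ℕ) (F : Type*) [Field F] [Finite F] :
    Nonempty (SLAut.groupA d F ≃* PGL(Fin d, F)) ∧
    (SLAut.groupA d F).Normal ∧
    SLAut.groupA d F ⊔ SLAut.groupB d F = ⊤ ∧
    (d ≠ 2 → Subgroup.IsComplement' (SLAut.groupA d F) (SLAut.groupB d F)) := by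
  have hn := SLAut.groupA_normal d F
  refine ⟨SLAut.nonempty_groupA_mulEquiv d F, hn, SLAut.groupA_sup_groupB d F, fun hd => ?_⟩
  refine Subgroup.isComplement'_of_disjoint_and_mul_eq_univ (SLAut.disjoint_groupA_groupB hd) ?_
  rw [← Subgroup.normal_mul, SLAut.groupA_sup_groupB, Subgroup.coe_top]
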